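/- Theorem 1.8. Let $G$ be a topological group (not assumed Hausdorff) and let $A$ be an abelian topological $G$-module: an abelian topological group, written multiplicatively and not assumed Hausdorff, on which $G$ acts by group automorphisms, $(g,a)\mapsto {}^{g}a$, such that the action map $G\times A\to A$ is continuous. Let $H^2(G,A)$ be the second cohomology group of $G$ with coefficients in $A$ in the sense of Hu. That is, $H^2(G,A)=Z^2(G,A)/B^2(G,A)$, where $Z^2(G,A)$ is the group of continuous maps $f:G\times G\to A$ with ${}^{g}f(h,k)\,f(gh,k)^{-1}f(g,hk)\,f(g,h)^{-1}=1$ for all $g,h,k\in G$, and $B^2(G,A)$ is the subgroup of the maps $(g,h)\mapsto {}^{g}c(h)\,c(gh)^{-1}c(g)$ with $c:G\to A$ continuous. A proper extension of $G$ by $A$ is a short exact sequence of topological groups $1\to A\xrightarrow{\chi}E\xrightarrow{\pi}G\to 1$ in which $\chi$ is a homeomorphic embedding and $\pi$ is a continuous open homomorphism. Consider the proper extensions that have a continuous section $s:G\to E$ (a continuous map, not necessarily a homomorphism, with $\pi s=\mathrm{Id}_G$) and that induce the given action, i.e. $\chi({}^{g}a)=s(g)\chi(a)s(g)^{-1}$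 for all $g\in G$, $a\in A$ and every continuous section $s$. Two of them, $(E_0,\chi_0,\pi_0)$ and $(E_1,\chi_1,\pi_1)$, are equivalent if there is a continuous homomorphism $\theta:E_0\to E_1$ with $\theta\chi_0=\chi_1$ and $\pi_1\theta=\pi_0$. Let $Opext_s(G,A)$ be the set of equivalence classes. The Baer sum of the classes of $(E_1,\chi_1,\pi_1)$ and $(E_2,\chi_2,\pi_2)$ is the class of the extension with middle group $$\{(x,y)\in E_1\times E_2 : \pi_1(x)=\pi_2(y)\}\,/\,\{(\chi_1(a),\chi_2(a)^{-1}) : a\in A\}$$ (the quotient topology of the subspace topology), inclusion $a\mapsto[(\chi_1(a),1)]$ and projection $[(x,y)]\mapsto\pi_1(x)$. Then $Opext_s(G,A)$ is an abelian group under the Baer sum, and this group is isomorphic to $H^2(G,A)$. -/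

import Mathlib

universe u v

/-! Topological groups are not assumed Hausdorff anywhere. An abelian topological `G`-module is an
abelian topological group `A`, written multiplicatively, with a jointly continuous action of `G` by
group automorphisms: `[MulDistribMulAction G A] [ContinuousSMul G A]`. -/

section Cohomology

variable (G : Type u) (A : Type v) [Group G] [TopologicalSpace G] [IsTopologicalGroup G]
  [CommGroup A] [TopologicalSpace A] [IsTopologicalGroup A]
  [MulDistribMulAction G A] [ContinuousSMul G A]

/-- The differential from continuous 1-cochains to continuous 2-cochains. -/
def huD1 : C(G, A) →* C(G × G, A) where
  toFun c := ⟨fun p => p.1 • c p.2 * (c (p.1 * p.2))⁻¹ * c p.1, by fun_prop⟩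
  map_one' := by ext p; simp
  map_mul' c d := by
    ext p
    simp only [ContinuousMap.coe_mk, ContinuousMap.mul_apply, smul_mul', mul_inv]
    ac_rfl

/-- The differential from continuous 2-cochains to continuous 3-cochains. -/
def huD2 : C(G × G, A) →* C(G × G × G, A) where
  toFun f := ⟨fun p => p.1 • f (p.2.1, p.2.2) * (f (p.1 * p.2.1, p.2.2))⁻¹ *
    f (p.1, p.2.1 * p.2.2) * (f (p.1, p.2.1))⁻¹, by fun_prop⟩
  map_one' := by ext p; simp
  map_mul' f f' := by
    ext p
    simp only [ContinuousMap.coe_mk, ContinuousMap.mul_apply, smul_mul', mul_inv]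
    ac_rfl

theorem huD2_huD1 (c : C(G, A)) : huD2 G A (huD1 G A c) = 1 := by
  ext ⟨g, h, k⟩
  simp only [huD1, huD2, MonoidHom.coe_mk, OneHom.coe_mk, ContinuousMap.coe_mk, smul_mul',
    smul_inv', mul_inv, inv_inv, mul_smul, mul_assoc, ContinuousMap.one_apply]
  simp only [← mul_assoc]
  rw [← div_eq_one]
  simp only [div_eq_mul_inv, inv_one, mul_one]
  generalize g • h • c k = x1
  generalize g • c (h * k) = x2
  generalize g • c h = x3
  generalize c (g * h * k) = x4
  generalize c (g * h) = x5
  generalize c g = x6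
  have key : ∀ x1 x2 x3 x4 x5 x6 : Additive A,
    x1 + -x2 + x3 + -x1 + x4 + -x5 + x2 + -x4 + x6 + -x3 + x5 + -x6 = 0 := by intros; abel
  exact key x1 x2 x3 x4 x5 x6

/-- Second cohomology in the sense of Hu: continuous 2-cocycles modulo coboundaries of continuous
1-cochains. -/
abbrev HuH2 : Type (max u v) :=
  (huD2 G A).ker ⧸ ((huD1 G A).range.subgroupOf (huD2 G A).ker)

end Cohomology

section Extensions

/-- A proper extension of `G` by `A`: a short exact sequence `1 → A → E → G → 1` of topological
groups whose first map is a homeomorphic embedding and whose second map is continuous and open.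
(`E` is in bijection with `A × G`, so nothing is lost by the choice of its universe.) -/
structure ProperExtension (G : Type u) (A : Type v) [Group G] [TopologicalSpace G]
    [Group A] [TopologicalSpace A] where
  E : Type (max u v)
  [group : Group E]
  [topologicalSpace : TopologicalSpace E]
  [isTopologicalGroup : IsTopologicalGroup E]
  /-- the underlying short exact sequence of groups -/
  seq : GroupExtension A E G
  isEmbedding_inl : Topology.IsEmbedding seq.inl
  continuous_rightHom : Continuous seq.rightHom
  isOpenMap_rightHom : IsOpenMap seq.rightHom

attribute [instance] ProperExtension.group ProperExtension.topologicalSpace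
  ProperExtension.isTopologicalGroup

namespace ProperExtension

variable {G : Type u} {A : Type v} [Group G] [TopologicalSpace G] [Group A] [TopologicalSpace A]

/-- The inclusion `A → E`. -/
abbrev inl (e : ProperExtension G A) : A →* e.E := e.seq.inl

/-- The projection `E → G`. -/
abbrev proj (e : ProperExtension G A) : e.E →* G := e.seq.rightHom

/-- Continuous sections (not necessarily homomorphisms). -/
def IsSection (e : ProperExtension G A) (s : G → e.E) : Prop :=
  Continuous s ∧ ∀ g, e.proj (s g) = g

end ProperExtension

/-- Proper extensions of `G` by the topological `G`-module `A` that have a continuous section and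
induce the given action of `G` on `A`. -/
structure OpextData (G : Type u) (A : Type v) [Group G] [TopologicalSpace G]
    [CommGroup A] [TopologicalSpace A] [MulDistribMulAction G A] extends ProperExtension G A where
  exists_section : ∃ s : G → E, toProperExtension.IsSection s
  induces_action : ∀ s : G → E, toProperExtension.IsSection s →
    ∀ (g : G) (a : A), toProperExtension.inl (g • a) = s g * toProperExtension.inl a * (s g)⁻¹

namespace OpextData

variable {G : Type u} {A : Type v} [Group G] [TopologicalSpace G]
  [CommGroup A] [TopologicalSpace A] [MulDistribMulAction G A]

abbrev inl (e : OpextData G A) : A →* e.E := e.seq.inl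

abbrev proj (e : OpextData G A) : e.E →* G := e.seq.rightHom

/-- Equivalence of extensions: a continuous homomorphism compatible with the inclusions of `A` and
the projections to `G`. -/
def Equivalent (e e' : OpextData G A) : Prop :=
  ∃ θ : e.E →* e'.E, Continuous θ ∧ (∀ a, θ (e.inl a) = e'.inl a) ∧
    ∀ x, e'.proj (θ x) = e.proj x

theorem proj_inl (e : OpextData G A) (a : A) : e.proj (e.inl a) = 1 := e.seq.rightHom_inl a

theorem exists_inl (e : OpextData G A) {x : e.E} (hx : e.proj x = 1) : ∃ a, e.inl a = x := by
  have : x ∈ e.seq.inl.range := by rw [e.seq.range_inl_eq_ker_rightHom]; exact hx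
  exact this

theorem inl_injective (e : OpextData G A) : Function.Injective e.inl := e.isEmbedding_inl.injective

theorem exists_coord (e : OpextData G A) {s : G → e.E} (hs : e.IsSection s) :
    ∃ k : e.E → A, Continuous k ∧ ∀ x, e.inl (k x) = x * (s (e.proj x))⁻¹ := by
  have h : ∀ x : e.E, ∃ a, e.inl a = x * (s (e.proj x))⁻¹ := fun x =>
    e.exists_inl (by simpa using congrArg (fun g => e.proj x * g⁻¹) (hs.2 (e.proj x)))
  choose k hk using h
  refine ⟨k, ?_, hk⟩
  rw [e.isEmbedding_inl.continuous_iff]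
  have : (e.seq.inl ∘ k) = fun x => x * (s (e.proj x))⁻¹ := funext hk
  rw [this]
  exact continuous_id.mul (hs.1.comp e.continuous_rightHom).inv

theorem conj_inl (e : OpextData G A) (x : e.E) (a : A) :
    x * e.inl a * x⁻¹ = e.inl (e.proj x • a) := by
  obtain ⟨s, hs⟩ := e.exists_section
  obtain ⟨k, -, hk⟩ := e.exists_coord hs
  have hx : x = e.inl (k x) * s (e.proj x) := by rw [hk]; group
  have h := e.induces_action s hs (e.proj x) a
  change e.inl _ = _ * e.inl a * _ at h
  calc x * e.inl a * x⁻¹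
      = e.inl (k x) * (s (e.proj x) * e.inl a * (s (e.proj x))⁻¹) * (e.inl (k x))⁻¹ := by
        conv_lhs => rw [hx]
        group
    _ = e.inl (e.proj x • a) := by
        rw [← h, ← map_mul, ← map_inv, ← map_mul, mul_inv_cancel_comm]

theorem Equivalent.refl (e : OpextData G A) : e.Equivalent e :=
  ⟨MonoidHom.id _, continuous_id, fun _ => rfl, fun _ => rfl⟩

theorem Equivalent.trans {e₁ e₂ e₃ : OpextData G A} (h : e₁.Equivalent e₂)
    (h' : e₂.Equivalent e₃) : e₁.Equivalent e₃ := by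
  obtain ⟨θ, hc, hi, hp⟩ := h
  obtain ⟨θ', hc', hi', hp'⟩ := h'
  exact ⟨θ'.comp θ, hc'.comp hc, fun a => by simp [hi, hi'], fun x => by simp [hp, hp']⟩

theorem Equivalent.symm {e e' : OpextData G A} (h : e.Equivalent e') : e'.Equivalent e := by
  obtain ⟨θ, hc, hi, hp⟩ := h
  obtain ⟨s, hs⟩ := e.exists_section
  have hs' : e'.IsSection (fun g => θ (s g)) :=
    ⟨hc.comp hs.1, fun g => (hp (s g)).trans (hs.2 g)⟩
  obtain ⟨k, hkc, hk⟩ := e'.exists_coord hs'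
  have hinj : Function.Injective θ := by
    rw [injective_iff_map_eq_one]
    intro x hx
    obtain ⟨a, rfl⟩ := e.exists_inl (x := x) (by rw [← hp, hx, map_one])
    rw [hi] at hx
    rw [e'.inl_injective (hx.trans (map_one e'.inl).symm), map_one]
  have hinv : ∀ y, θ (e.inl (k y) * s (e'.proj y)) = y := fun y => by
    rw [map_mul, hi, hk, inv_mul_cancel_right]
  refine ⟨⟨⟨fun y => e.inl (k y) * s (e'.proj y), ?_⟩, ?_⟩, ?_, ?_, ?_⟩
  · apply hinj; rw [hinv, map_one]
  · intro x y
    apply hinj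
    change θ (_ * _) = θ (_ * _ * (_ * _))
    rw [hinv, map_mul, hinv, hinv]
  · exact (e.isEmbedding_inl.continuous.comp hkc).mul (hs.1.comp e'.continuous_rightHom)
  · intro a
    apply hinj
    exact (hinv _).trans (hi a).symm
  · intro y
    exact (hp _).symm.trans (congrArg e'.proj (hinv y))

/-- Equivalence of extensions as a setoid. -/
instance setoid (G : Type u) (A : Type v) [Group G] [TopologicalSpace G]
    [CommGroup A] [TopologicalSpace A] [MulDistribMulAction G A] : Setoid (OpextData G A) where
  r := Equivalent
  iseqv := ⟨Equivalent.refl, Equivalent.symm, Equivalent.trans⟩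

/-- The fibre product of the two middle groups over `G`, a topological subgroup of the product. -/
def fibre (e₁ e₂ : OpextData G A) : Subgroup (e₁.E × e₂.E) where
  carrier := {p | e₁.proj p.1 = e₂.proj p.2}
  one_mem' := by simp
  mul_mem' {p q} hp hq := by simp_all
  inv_mem' {p} hp := by simp_all

/-- The antidiagonal copy `{(a, a⁻¹)}` of `A` in the fibre product. -/
def antidiag (e₁ e₂ : OpextData G A) : Subgroup (fibre e₁ e₂) where
  carrier := {p | ∃ a : A, p.1 = (e₁.inl a, e₂.inl a⁻¹)}
  one_mem' := ⟨1, by simp only [inv_one, map_one]; rfl⟩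
  mul_mem' := by
    rintro p q ⟨a, ha⟩ ⟨b, hb⟩
    exact ⟨a * b, by rw [Subgroup.coe_mul, ha, hb, mul_inv, map_mul, map_mul]; rfl⟩
  inv_mem' := by
    rintro p ⟨a, ha⟩
    exact ⟨a⁻¹, by rw [Subgroup.coe_inv, ha, Prod.inv_mk, ← map_inv, ← map_inv]⟩

instance antidiag_normal (e₁ e₂ : OpextData G A) : (antidiag e₁ e₂).Normal where
  conj_mem := by
    rintro p ⟨a, ha⟩ q
    refine ⟨e₁.proj q.1.1 • a, ?_⟩
    have hq : e₁.proj q.1.1 = e₂.proj q.1.2 := q.2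
    rw [Subgroup.coe_mul, Subgroup.coe_mul, Subgroup.coe_inv, ha]
    refine Prod.ext ?_ ?_
    · exact e₁.conj_inl _ _
    · change q.1.2 * e₂.inl a⁻¹ * (q.1.2)⁻¹ = _
      rw [e₂.conj_inl, hq, smul_inv']

/-- The middle group of the Baer sum: the fibre product over `G` modulo the antidiagonal copy of
`A`, with the quotient topology. -/
abbrev BaerGroup (e₁ e₂ : OpextData G A) : Type (max u v) := fibre e₁ e₂ ⧸ antidiag e₁ e₂

/-- The inclusion of `A` in the Baer sum, `a ↦ [(a, 1)]`. -/
def baerInl (e₁ e₂ : OpextData G A) : A →* BaerGroup e₁ e₂ where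
  toFun a := ((⟨(e₁.inl a, 1), by
    change e₁.proj (e₁.inl a) = e₂.proj 1
    rw [proj_inl, map_one]⟩ : fibre e₁ e₂) : BaerGroup e₁ e₂)
  map_one' := (QuotientGroup.eq_one_iff _).2 ⟨1, by simp⟩
  map_mul' a b := by
    rw [← QuotientGroup.mk_mul]
    congr 1
    ext <;> simp

/-- The projection of the Baer sum to `G`, `[(x, y)] ↦ π₁ x = π₂ y`. -/
def baerProj (e₁ e₂ : OpextData G A) : BaerGroup e₁ e₂ →* G :=
  QuotientGroup.lift (antidiag e₁ e₂)
    ((e₁.proj.comp (MonoidHom.fst e₁.E e₂.E)).comp (fibre e₁ e₂).subtype) (by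
      rintro p ⟨a, ha⟩
      change e₁.proj p.1.1 = 1
      rw [ha, proj_inl])

theorem baerProj_mk (e₁ e₂ : OpextData G A) (p : fibre e₁ e₂) :
    baerProj e₁ e₂ (p : BaerGroup e₁ e₂) = e₁.proj p.1.1 := rfl

theorem continuous_baerProj (e₁ e₂ : OpextData G A) : Continuous (baerProj e₁ e₂) :=
  continuous_quot_lift _
    (e₁.continuous_rightHom.comp (continuous_fst.comp continuous_subtype_val))

theorem baer_section (e₁ e₂ : OpextData G A) :
    ∃ s : G → BaerGroup e₁ e₂, Continuous s ∧ ∀ g, baerProj e₁ e₂ (s g) = g := by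
  obtain ⟨s₁, h₁⟩ := e₁.exists_section
  obtain ⟨s₂, h₂⟩ := e₂.exists_section
  refine ⟨fun g => ((⟨(s₁ g, s₂ g), (h₁.2 g).trans (h₂.2 g).symm⟩ : fibre e₁ e₂) :
    BaerGroup e₁ e₂), ?_, fun g => h₁.2 g⟩
  exact continuous_quot_mk.comp ((h₁.1.prodMk h₂.1).subtype_mk _)

theorem continuous_baerInl (e₁ e₂ : OpextData G A) : Continuous (baerInl e₁ e₂) :=
  continuous_quot_mk.comp
    ((e₁.isEmbedding_inl.continuous.prodMk continuous_const).subtype_mk _)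

theorem isOpenMap_baerProj (e₁ e₂ : OpextData G A) : IsOpenMap (baerProj e₁ e₂) := by
  obtain ⟨s, hs, hsp⟩ := baer_section e₁ e₂
  intro U hU
  rw [isOpen_iff_mem_nhds]
  rintro _ ⟨x, hx, rfl⟩
  have hc : Continuous fun g => s g * (s (baerProj e₁ e₂ x))⁻¹ * x := by fun_prop
  have hV := (hU.preimage hc).mem_nhds (x := baerProj e₁ e₂ x) (by simpa using hx)
  refine Filter.mem_of_superset hV fun g hg => ⟨_, hg, ?_⟩
  rw [map_mul, map_mul, map_inv, hsp, hsp, inv_mul_cancel_right]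

theorem isEmbedding_baerInl [IsTopologicalGroup A] (e₁ e₂ : OpextData G A) :
    Topology.IsEmbedding (baerInl e₁ e₂) := by
  obtain ⟨s₁, h₁⟩ := e₁.exists_section
  obtain ⟨s₂, h₂⟩ := e₂.exists_section
  obtain ⟨k₁, hc₁, hk₁⟩ := e₁.exists_coord h₁
  obtain ⟨k₂, hc₂, hk₂⟩ := e₂.exists_coord h₂
  have hl₁ : ∀ x a, k₁ (x * e₁.inl a) = (e₁.proj x • a) * k₁ x := fun x a => by
    apply e₁.inl_injective
    rw [hk₁, map_mul, map_mul, hk₁, proj_inl, mul_one, ← conj_inl]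
    group
  have hl₂ : ∀ x a, k₂ (x * e₂.inl a) = (e₂.proj x • a) * k₂ x := fun x a => by
    apply e₂.inl_injective
    rw [hk₂, map_mul, map_mul, hk₂, proj_inl, mul_one, ← conj_inl]
    group
  let F : BaerGroup e₁ e₂ → A := Quotient.lift
    (fun p : fibre e₁ e₂ => k₁ p.1.1 * k₂ p.1.2) (by
      intro p q hpq
      obtain ⟨a, ha⟩ := QuotientGroup.leftRel_apply.1 hpq
      have hp : e₁.proj p.1.1 = e₂.proj p.1.2 := p.2
      have hq : q.1 = p.1 * (e₁.inl a, e₂.inl a⁻¹) := by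
        rw [← ha, ← Subgroup.coe_mul, mul_inv_cancel_left]
      change k₁ p.1.1 * k₂ p.1.2 = k₁ q.1.1 * k₂ q.1.2
      rw [hq, Prod.fst_mul, Prod.snd_mul, hl₁, hl₂, hp, smul_inv', mul_mul_mul_comm,
        mul_inv_cancel, one_mul])
  have hF : Continuous F := continuous_quot_lift _
    ((hc₁.comp (continuous_fst.comp continuous_subtype_val)).mul
      (hc₂.comp (continuous_snd.comp continuous_subtype_val)))
  have hFi : F ∘ baerInl e₁ e₂ = fun a => a * (k₁ 1 * k₂ 1) := by
    funext a
    change k₁ (e₁.inl a) * k₂ 1 = _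
    rw [← one_mul (e₁.inl a), hl₁, map_one, one_smul, mul_assoc]
  refine Topology.IsEmbedding.of_comp (continuous_baerInl e₁ e₂) hF ?_
  rw [hFi]
  exact (Homeomorph.mulRight (k₁ 1 * k₂ 1)).isEmbedding

/-- The Baer sum of two extensions. -/
def baer [IsTopologicalGroup A] (e₁ e₂ : OpextData G A) : OpextData G A where
  E := BaerGroup e₁ e₂
  seq :=
    { inl := baerInl e₁ e₂
      rightHom := baerProj e₁ e₂
      inl_injective := (isEmbedding_baerInl e₁ e₂).injective
      range_inl_eq_ker_rightHom := by
        ext x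
        constructor
        · rintro ⟨a, rfl⟩
          exact e₁.proj_inl a
        · obtain ⟨p, rfl⟩ := QuotientGroup.mk_surjective x
          intro hp
          have h₁ : e₁.proj p.1.1 = 1 := hp
          have h₂ : e₂.proj p.1.2 = 1 := Eq.trans (Eq.symm p.2) h₁
          obtain ⟨a, ha⟩ := e₁.exists_inl h₁
          obtain ⟨b, hb⟩ := e₂.exists_inl h₂
          refine ⟨a * b, QuotientGroup.eq.2 ⟨b⁻¹, ?_⟩⟩
          refine Prod.ext ?_ ?_
          · change (e₁.inl (a * b))⁻¹ * p.1.1 = e₁.inl b⁻¹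
            rw [← ha, ← map_inv, ← map_mul]
            congr 1
            simp
          · change (1 : e₂.E)⁻¹ * p.1.2 = e₂.inl b⁻¹⁻¹
            rw [← hb, inv_one, one_mul, inv_inv]
      rightHom_surjective := fun g => by
        obtain ⟨s, -, hs⟩ := baer_section e₁ e₂
        exact ⟨s g, hs g⟩ }
  isEmbedding_inl := isEmbedding_baerInl e₁ e₂
  continuous_rightHom := continuous_baerProj e₁ e₂
  isOpenMap_rightHom := isOpenMap_baerProj e₁ e₂
  exists_section := baer_section e₁ e₂
  induces_action := by
    intro s hs g a
    obtain ⟨p, hp⟩ := QuotientGroup.mk_surjective (s g)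
    have hg : e₁.proj p.1.1 = g := by
      have h : baerProj e₁ e₂ (s g) = g := hs.2 g
      rwa [← hp] at h
    change baerInl e₁ e₂ (g • a) = s g * baerInl e₁ e₂ a * (s g)⁻¹
    rw [← hp, ← hg]
    change QuotientGroup.mk _ = QuotientGroup.mk _
    congr 1
    refine Subtype.ext (Prod.ext ?_ ?_)
    · exact (e₁.conj_inl _ _).symm
    · change (1 : e₂.E) = p.1.2 * 1 * (p.1.2)⁻¹
      rw [mul_one, mul_inv_cancel]

theorem baer_equivalent [IsTopologicalGroup A] {e₁ e₂ e₁' e₂' : OpextData G A}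
    (h₁ : e₁.Equivalent e₁') (h₂ : e₂.Equivalent e₂') :
    (baer e₁ e₂).Equivalent (baer e₁' e₂') := by
  obtain ⟨θ₁, hc₁, hi₁, hp₁⟩ := h₁
  obtain ⟨θ₂, hc₂, hi₂, hp₂⟩ := h₂
  let Θ : fibre e₁ e₂ →* fibre e₁' e₂' :=
    ((θ₁.prodMap θ₂).comp (fibre e₁ e₂).subtype).codRestrict (fibre e₁' e₂') (fun p =>
      (hp₁ p.1.1).trans (Eq.trans p.2 (hp₂ p.1.2).symm))
  have hΘ : Continuous Θ := ((hc₁.prodMap hc₂).comp continuous_subtype_val).subtype_mk _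
  have hle : antidiag e₁ e₂ ≤ (antidiag e₁' e₂').comap Θ := by
    rintro p ⟨a, ha⟩
    refine ⟨a, Prod.ext ?_ ?_⟩
    · change θ₁ p.1.1 = _
      rw [ha, hi₁]
    · change θ₂ p.1.2 = _
      rw [ha, hi₂]
  refine ⟨QuotientGroup.map _ _ Θ hle, ?_, ?_, ?_⟩
  · exact continuous_quot_lift _ (continuous_quot_mk.comp hΘ)
  · intro a
    change QuotientGroup.mk _ = QuotientGroup.mk _
    congr 1
    refine Subtype.ext (Prod.ext ?_ ?_)
    · exact hi₁ a
    · exact map_one θ₂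
  · intro x
    obtain ⟨p, rfl⟩ := QuotientGroup.mk_surjective x
    exact hp₁ p.1.1

end OpextData

/-- `Opext_s(G, A)`: equivalence classes of proper extensions of `G` by the module `A` that have
continuous sections and induce the given action. -/
def Opext (G : Type u) (A : Type v) [Group G] [TopologicalSpace G]
    [CommGroup A] [TopologicalSpace A] [MulDistribMulAction G A] : Type (max (u + 1) (v + 1)) :=
  Quotient (OpextData.setoid G A)

/-- The Baer sum on equivalence classes. -/
def Opext.baerSum {G : Type u} {A : Type v} [Group G] [TopologicalSpace G]
    [CommGroup A] [TopologicalSpace A] [IsTopologicalGroup A] [MulDistribMulAction G A] :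
    Opext G A → Opext G A → Opext G A :=
  Quotient.map₂ OpextData.baer
    (fun _ _ h₁ _ _ h₂ => OpextData.baer_equivalent h₁ h₂)

end Extensions

/-! A continuous section `s` of an extension `e` has a factor set: the continuous 2-cocycle `f` with
`s g * s h = f (g, h) * s (g * h)`. The classical correspondence between extensions and factor sets
survives in the topological setting because everything is expressed through the coordinate
`x ↦ x * (s (π x))⁻¹ ∈ A`, which is continuous since `A` is embedded in `E`.

Every extension has a factor set (`OpextData.exists_isFactorSet`); two factor sets of the same
extension differ by a coboundary and every cocycle cohomologous to a factor set is again one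
(`IsFactorSet.exists_eq_mul_huD1`, `IsFactorSet.mul_huD1`); extensions sharing a factor set are
equivalent (`IsFactorSet.equivalent`); and every cocycle `f` is the factor set of `A × G` with the
product topology and multiplication twisted by `f` (`crossedExtension_isFactorSet`). So
`f ↦ [A ×_f G]` induces a bijection from `H²(G, A)` to `Opext_s(G, A)`. If `f₁`, `f₂` are factor sets
of `e₁`, `e₂`, then `f₁ * f₂` is one of their Baer sum, for the section `g ↦ [(s₁ g, s₂ g)]`
(`IsFactorSet.baer`). The bijection thus carries multiplication of classes to the Baer sum, which
is therefore an abelian group law, and the bijection is an isomorphism. -/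

namespace OpextData

/-! ### Factor sets of sections -/

section FactorSet

variable {G : Type u} {A : Type v} [Group G] [TopologicalSpace G]
  [CommGroup A] [TopologicalSpace A] [MulDistribMulAction G A]

/-- `f` is the factor set of the continuous section `s` of `e`: it measures the failure of `s` to be
multiplicative. Neither `s` nor `f` is required to be normalized. -/
structure IsFactorSet (e : OpextData G A) (s : G → e.E) (f : G × G → A) : Prop where
  isSection : e.IsSection s
  mul_eq : ∀ g h, s g * s h = e.inl (f (g, h)) * s (g * h)

theorem mul_inl (e : OpextData G A) (x : e.E) (a : A) :
    x * e.inl a = e.inl (e.proj x • a) * x := by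
  rw [← conj_inl, inv_mul_cancel_right]

/-- Multiplication in the coordinates given by a section. -/
theorem IsFactorSet.inl_mul_inl_mul {e : OpextData G A} {s : G → e.E} {f : G × G → A}
    (hs : e.IsFactorSet s f) (a b : A) (g h : G) :
    (e.inl a * s g) * (e.inl b * s h) = e.inl (a * g • b * f (g, h)) * s (g * h) := by
  have hp : e.proj (s g) = g := hs.isSection.2 g
  rw [mul_assoc, ← mul_assoc (s g), mul_inl, hp, mul_assoc, hs.mul_eq]
  simp only [map_mul, mul_assoc]

theorem IsFactorSet.section_one {e : OpextData G A} {s : G → e.E} {f : G × G → A}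
    (hs : e.IsFactorSet s f) : s 1 = e.inl (f (1, 1)) := by
  have h := hs.mul_eq 1 1
  rw [mul_one] at h
  exact mul_right_cancel h

/-- Extensions with a common factor set are equivalent. -/
theorem IsFactorSet.equivalent {e e' : OpextData G A} {s : G → e.E} {s' : G → e'.E}
    {f : G × G → A} (hs : e.IsFactorSet s f) (hs' : e'.IsFactorSet s' f) : e.Equivalent e' := by
  obtain ⟨k, hkc, hk⟩ := e.exists_coord hs.isSection
  have hx : ∀ x, e.inl (k x) * s (e.proj x) = x := fun x => by rw [hk, inv_mul_cancel_right]
  have hkmul : ∀ x y, k (x * y) = k x * e.proj x • k y * f (e.proj x, e.proj y) := fun x y => by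
    apply e.inl_injective
    apply mul_right_cancel (b := s (e.proj (x * y)))
    rw [hx, map_mul e.proj, ← hs.inl_mul_inl_mul, hx, hx]
  let θ : e.E →* e'.E := MonoidHom.mk' (fun x => e'.inl (k x) * s' (e.proj x)) fun x y => by
    rw [hs'.inl_mul_inl_mul, hkmul, map_mul e.proj]
  refine ⟨θ, ?_, fun a => ?_, fun x => ?_⟩
  · exact (e'.isEmbedding_inl.continuous.comp hkc).mul
      (hs'.isSection.1.comp e.continuous_rightHom)
  · have ha : k (e.inl a) * f (1, 1) = a := by
      apply e.inl_injective
      rw [map_mul, hk, proj_inl, hs.section_one, inv_mul_cancel_right]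
    change e'.inl (k (e.inl a)) * s' (e.proj (e.inl a)) = e'.inl a
    rw [proj_inl, hs'.section_one, ← map_mul, ha]
  · change e'.proj (e'.inl (k x) * s' (e.proj x)) = e.proj x
    rw [map_mul, proj_inl, one_mul]
    exact hs'.isSection.2 _

theorem IsFactorSet.of_equivalent {e e' : OpextData G A} {s : G → e.E} {f : G × G → A}
    (hs : e.IsFactorSet s f) (h : e.Equivalent e') : ∃ s', e'.IsFactorSet s' f := by
  obtain ⟨θ, hc, hi, hp⟩ := h
  refine ⟨fun g => θ (s g), ⟨hc.comp hs.isSection.1, fun g => ?_⟩, fun g h => ?_⟩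
  · exact (hp _).trans (hs.isSection.2 g)
  · rw [← map_mul, hs.mul_eq, map_mul, hi]

/-- Factor sets multiply under the Baer sum. -/
theorem IsFactorSet.baer [IsTopologicalGroup A] {e₁ e₂ : OpextData G A} {s₁ : G → e₁.E}
    {s₂ : G → e₂.E} {f₁ f₂ : G × G → A} (h₁ : e₁.IsFactorSet s₁ f₁) (h₂ : e₂.IsFactorSet s₂ f₂) :
    ∃ s, (baer e₁ e₂).IsFactorSet s (f₁ * f₂) := by
  let t : G → fibre e₁ e₂ := fun g =>
    ⟨(s₁ g, s₂ g), (h₁.isSection.2 g).trans (h₂.isSection.2 g).symm⟩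
  have ht : Continuous t := (h₁.isSection.1.prodMk h₂.isSection.1).subtype_mk _
  refine ⟨fun g => (t g : BaerGroup e₁ e₂),
    ⟨continuous_quot_mk.comp ht, fun g => h₁.isSection.2 g⟩, fun g h => ?_⟩
  change ((t g * t h : fibre e₁ e₂) : BaerGroup e₁ e₂) =
    baerInl e₁ e₂ (f₁ (g, h) * f₂ (g, h)) * (t (g * h) : BaerGroup e₁ e₂)
  -- `(f₁, f₂)` and `(f₁ * f₂, 1)` agree modulo the antidiagonal; left and right cosets coincide,
  -- and the quotient relation is stated with left ones, hence the action of `(g * h)⁻¹`.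
  refine QuotientGroup.eq.2 ⟨(g * h)⁻¹ • f₂ (g, h), ?_⟩
  have key : ∀ (e : OpextData G A) (x : e.E) (a b : A), e.proj x = g * h →
      (e.inl a * x)⁻¹ * (e.inl b * x) = e.inl ((g * h)⁻¹ • (a⁻¹ * b)) := by
    intro e x a b hx
    have := e.conj_inl x⁻¹ (a⁻¹ * b)
    rw [map_inv, hx] at this
    rw [← this, map_mul, map_inv]
    group
  refine Prod.ext ?_ ?_
  · change (s₁ g * s₁ h)⁻¹ * (e₁.inl (f₁ (g, h) * f₂ (g, h)) * s₁ (g * h)) =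
      e₁.inl ((g * h)⁻¹ • f₂ (g, h))
    rw [h₁.mul_eq, key e₁ _ _ _ (h₁.isSection.2 _), inv_mul_cancel_left]
  · change (s₂ g * s₂ h)⁻¹ * (1 * s₂ (g * h)) = e₂.inl ((g * h)⁻¹ • f₂ (g, h))⁻¹
    have := key e₂ _ (f₂ (g, h)) 1 (h₂.isSection.2 _)
    rw [map_one] at this
    rw [h₂.mul_eq, this, mul_one, smul_inv']

end FactorSet

/-! ### Cocycles and coboundaries -/

section Cocycle

variable {G : Type u} {A : Type v} [Group G] [TopologicalSpace G] [IsTopologicalGroup G]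
  [CommGroup A] [TopologicalSpace A] [IsTopologicalGroup A]
  [MulDistribMulAction G A] [ContinuousSMul G A]

theorem mem_ker_huD2_iff (f : C(G × G, A)) :
    f ∈ (huD2 G A).ker ↔
      ∀ g h k, f (g, h) * f (g * h, k) = g • f (h, k) * f (g, h * k) := by
  rw [MonoidHom.mem_ker, ContinuousMap.ext_iff]
  have key : ∀ w x y z : A, w * x⁻¹ * y * z⁻¹ = 1 ↔ z * x = w * y := fun w x y z => by
    rw [mul_inv_eq_one, mul_right_comm, mul_inv_eq_iff_eq_mul, eq_comm]
  exact ⟨fun H g h k => (key _ _ _ _).1 (H (g, h, k)),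
    fun H p => (key _ _ _ _).2 (H p.1 p.2.1 p.2.2)⟩

/-- Every extension has a factor set, and it is a continuous 2-cocycle. -/
theorem exists_isFactorSet (e : OpextData G A) :
    ∃ s, ∃ f : (huD2 G A).ker, e.IsFactorSet s f.1 := by
  obtain ⟨s, hs⟩ := e.exists_section
  obtain ⟨k, hkc, hk⟩ := e.exists_coord hs
  have hsp : ∀ g, e.proj (s g) = g := hs.2
  have hsc : Continuous s := hs.1
  let f : C(G × G, A) := ⟨fun p => k (s p.1 * s p.2), by fun_prop⟩
  have hf : e.IsFactorSet s f := ⟨hs, fun g h => by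
    change _ = e.inl (k (s g * s h)) * _
    rw [hk, map_mul, hsp, hsp, inv_mul_cancel_right]⟩
  refine ⟨s, ⟨f, (mem_ker_huD2_iff f).2 fun g h l => ?_⟩, hf⟩
  -- the cocycle identity is associativity of `s g * s h * s l`
  apply e.inl_injective
  apply mul_right_cancel (b := s (g * h * l))
  have h₁ := hf.inl_mul_inl_mul (f (g, h)) 1 (g * h) l
  have h₂ := hf.inl_mul_inl_mul 1 (f (h, l)) g (h * l)
  rw [smul_one, mul_one, map_one, one_mul, ← hf.mul_eq] at h₁
  rw [one_mul, map_one, one_mul, ← hf.mul_eq, ← mul_assoc g] at h₂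
  rw [← h₁, ← h₂, mul_assoc]

/-- Multiplying a section by a continuous `c : G → A` multiplies its factor set by the coboundary
of `c`. -/
theorem IsFactorSet.mul_huD1 {e : OpextData G A} {s : G → e.E} {f : C(G × G, A)}
    (hs : e.IsFactorSet s f) (c : C(G, A)) :
    e.IsFactorSet (fun g => e.inl (c g) * s g) (f * huD1 G A c : C(G × G, A)) := by
  refine ⟨⟨(e.isEmbedding_inl.continuous.comp c.continuous).mul hs.isSection.1, fun g => ?_⟩,
    fun g h => ?_⟩
  · change e.proj (e.inl (c g) * s g) = g
    rw [map_mul, proj_inl, one_mul]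
    exact hs.isSection.2 g
  · rw [hs.inl_mul_inl_mul, ← mul_assoc, ← map_mul]
    congr 2
    change _ = f (g, h) * (g • c h * (c (g * h))⁻¹ * c g) * c (g * h)
    rw [mul_right_comm _ _ (c g), ← mul_assoc (f (g, h)), inv_mul_cancel_right, mul_comm,
      mul_comm (c g)]

/-- Two factor sets of the same extension are cohomologous. -/
theorem IsFactorSet.exists_eq_mul_huD1 {e : OpextData G A} {s s' : G → e.E} {f f' : C(G × G, A)}
    (hs : e.IsFactorSet s f) (hs' : e.IsFactorSet s' f') :
    ∃ c : C(G, A), f' = f * huD1 G A c := by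
  obtain ⟨k, hkc, hk⟩ := e.exists_coord hs.isSection
  let c : C(G, A) := ⟨fun g => k (s' g), hkc.comp hs'.isSection.1⟩
  have hc : (fun g => e.inl (c g) * s g) = s' := funext fun g => by
    have hp : e.proj (s' g) = g := hs'.isSection.2 g
    change e.inl (k (s' g)) * s g = s' g
    rw [hk, hp, inv_mul_cancel_right]
  have h := hs.mul_huD1 c
  rw [hc] at h
  refine ⟨c, ContinuousMap.ext fun p => e.inl_injective ?_⟩
  exact mul_right_cancel ((hs'.mul_eq p.1 p.2).symm.trans (h.mul_eq p.1 p.2))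

end Cocycle

end OpextData

/-! ### The crossed product of a cocycle -/

section CrossedProduct

variable {G : Type u} {A : Type v} [Group G] [TopologicalSpace G] [IsTopologicalGroup G]
  [CommGroup A] [TopologicalSpace A] [IsTopologicalGroup A]
  [MulDistribMulAction G A] [ContinuousSMul G A]

theorem cocycle_mul (f : (huD2 G A).ker) (g h k : G) :
    f.1 (g, h) * f.1 (g * h, k) = g • f.1 (h, k) * f.1 (g, h * k) :=
  (OpextData.mem_ker_huD2_iff f.1).1 f.2 g h k

theorem cocycle_one_left (f : (huD2 G A).ker) (g : G) : f.1 (1, g) = f.1 (1, 1) := by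
  have h := cocycle_mul f 1 1 g
  rw [one_smul, one_mul, one_mul] at h
  exact (mul_right_cancel h).symm

theorem cocycle_one_right (f : (huD2 G A).ker) (g : G) : f.1 (g, 1) = g • f.1 (1, 1) := by
  have h := cocycle_mul f g 1 1
  rw [mul_one, mul_one] at h
  exact mul_right_cancel h

/-- The space `A × G`, to be given the multiplication
`(a, g) * (b, h) = (a * g • b * f (g, h), g * h)` twisted by the cocycle `f`. -/
@[nolint unusedArguments]
def CrossedProduct (_ : (huD2 G A).ker) : Type (max u v) := A × G

namespace CrossedProduct

variable (f : (huD2 G A).ker)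

instance : TopologicalSpace (CrossedProduct f) := inferInstanceAs (TopologicalSpace (A × G))

instance : Mul (CrossedProduct f) :=
  ⟨fun x y => (x.1 * x.2 • y.1 * f.1 (x.2, y.2), x.2 * y.2)⟩

/-- Since `f` is not assumed normalized, the unit is `(f (1, 1)⁻¹, 1)`. -/
instance : One (CrossedProduct f) := ⟨((f.1 (1, 1))⁻¹, 1)⟩

instance : Inv (CrossedProduct f) :=
  ⟨fun x => ((x.2⁻¹ • x.1 * f.1 (x.2⁻¹, x.2) * f.1 (1, 1))⁻¹, x.2⁻¹)⟩

instance : Group (CrossedProduct f) := Group.ofLeftAxioms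
  (by
    rintro ⟨a, g⟩ ⟨b, h⟩ ⟨c, k⟩
    refine Prod.ext ?_ (mul_assoc g h k)
    change a * g • b * f.1 (g, h) * (g * h) • c * f.1 (g * h, k) =
      a * g • (b * h • c * f.1 (h, k)) * f.1 (g, h * k)
    rw [mul_right_comm _ (f.1 (g, h)), mul_assoc _ (f.1 (g, h)), cocycle_mul]
    simp only [smul_mul', mul_smul, mul_assoc])
  (by
    rintro ⟨a, g⟩
    refine Prod.ext ?_ (one_mul g)
    change (f.1 (1, 1))⁻¹ * (1 : G) • a * f.1 (1, g) = a
    rw [one_smul, cocycle_one_left f g, mul_right_comm, inv_mul_cancel, one_mul])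
  (by
    rintro ⟨a, g⟩
    refine Prod.ext ?_ (inv_mul_cancel g)
    change (g⁻¹ • a * f.1 (g⁻¹, g) * f.1 (1, 1))⁻¹ * g⁻¹ • a * f.1 (g⁻¹, g) =
      (f.1 (1, 1))⁻¹
    rw [mul_assoc, mul_inv_rev, inv_mul_cancel_right])

instance : IsTopologicalGroup (CrossedProduct f) where
  continuous_mul := by
    change Continuous fun p : (A × G) × (A × G) =>
      (p.1.1 * p.1.2 • p.2.1 * f.1 (p.1.2, p.2.2), p.1.2 * p.2.2)
    fun_prop
  continuous_inv := by
    change Continuous fun x : A × G =>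
      ((x.2⁻¹ • x.1 * f.1 (x.2⁻¹, x.2) * f.1 (1, 1))⁻¹, x.2⁻¹)
    fun_prop

/-- The inclusion `a ↦ (a * f (1, 1)⁻¹, 1)` of `A` in the crossed product. -/
def inl : A →* CrossedProduct f :=
  MonoidHom.mk' (fun a => (a * (f.1 (1, 1))⁻¹, 1)) fun a b => by
    refine Prod.ext ?_ (one_mul 1).symm
    change a * b * (f.1 (1, 1))⁻¹ =
      a * (f.1 (1, 1))⁻¹ * (1 : G) • (b * (f.1 (1, 1))⁻¹) * f.1 (1, 1)
    rw [one_smul, ← mul_assoc, inv_mul_cancel_right, mul_right_comm]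

/-- The projection `(a, g) ↦ g` of the crossed product to `G`. -/
def proj : CrossedProduct f →* G := MonoidHom.mk' (fun x => x.2) fun _ _ => rfl

theorem inl_mul (a : A) (x : CrossedProduct f) : inl f a * x = (a * x.1, x.2) := by
  obtain ⟨b, g⟩ := x
  refine Prod.ext ?_ (one_mul g)
  change a * (f.1 (1, 1))⁻¹ * (1 : G) • b * f.1 (1, g) = a * b
  rw [one_smul, cocycle_one_left f g, mul_right_comm, inv_mul_cancel_right]

theorem mul_inl (x : CrossedProduct f) (a : A) : x * inl f a = inl f (x.2 • a) * x := by
  rw [inl_mul]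
  obtain ⟨b, g⟩ := x
  refine Prod.ext ?_ (mul_one g)
  change b * g • (a * (f.1 (1, 1))⁻¹) * f.1 (g, 1) = g • a * b
  rw [cocycle_one_right f g, smul_mul', smul_inv', ← mul_assoc, inv_mul_cancel_right, mul_comm]

theorem isEmbedding_inl : Topology.IsEmbedding (inl f) := by
  have hi : Continuous (inl f) := by
    change Continuous fun a : A => (a * (f.1 (1, 1))⁻¹, (1 : G))
    fun_prop
  refine Topology.IsEmbedding.of_comp (g := fun x : A × G => x.1) hi continuous_fst ?_
  exact (Homeomorph.mulRight (f.1 (1, 1))⁻¹).isEmbedding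

end CrossedProduct

open CrossedProduct in
/-- The crossed product of the cocycle `f` as an extension of `G` by `A`, with section
`g ↦ (1, g)`. -/
def crossedExtension (f : (huD2 G A).ker) : OpextData G A where
  E := CrossedProduct f
  seq :=
    { inl := inl f
      rightHom := proj f
      inl_injective := (isEmbedding_inl f).injective
      range_inl_eq_ker_rightHom := by
        ext x
        constructor
        · rintro ⟨a, rfl⟩
          rfl
        · intro hx
          exact ⟨x.1 * f.1 (1, 1), Prod.ext (mul_inv_cancel_right _ _) (Eq.symm hx)⟩
      rightHom_surjective := fun g => ⟨(1, g), rfl⟩ }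
  isEmbedding_inl := isEmbedding_inl f
  continuous_rightHom := (continuous_snd : Continuous fun x : A × G => x.2)
  isOpenMap_rightHom := (isOpenMap_snd : IsOpenMap fun x : A × G => x.2)
  exists_section := ⟨fun g => ((1, g) : A × G),
    (by fun_prop : Continuous fun g : G => ((1, g) : A × G)), fun _ => rfl⟩
  induces_action := fun s hs g a => by
    have hg : (s g).2 = g := hs.2 g
    change inl f (g • a) = s g * inl f a * (s g)⁻¹
    rw [mul_inl, hg, mul_inv_cancel_right]

theorem crossedExtension_isFactorSet (f : (huD2 G A).ker) :
    ∃ s, (crossedExtension f).IsFactorSet s f.1 := by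
  refine ⟨fun g => ((1, g) : A × G),
    ⟨(by fun_prop : Continuous fun g : G => ((1, g) : A × G)), fun _ => rfl⟩, fun g h => ?_⟩
  refine Eq.trans ?_ (CrossedProduct.inl_mul f _ _).symm
  refine Prod.ext ?_ rfl
  change 1 * g • (1 : A) * f.1 (g, h) = f.1 (g, h) * 1
  rw [smul_one, one_mul, one_mul, mul_one]

end CrossedProduct

/-! ### The isomorphism -/

section Isomorphism

variable {G : Type u} {A : Type v} [Group G] [TopologicalSpace G] [IsTopologicalGroup G]
  [CommGroup A] [TopologicalSpace A] [IsTopologicalGroup A]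
  [MulDistribMulAction G A] [ContinuousSMul G A]

theorem crossedExtension_equivalent_iff (f f' : (huD2 G A).ker) :
    (crossedExtension f).Equivalent (crossedExtension f') ↔
      ∃ c : C(G, A), f'.1 = f.1 * huD1 G A c := by
  obtain ⟨s, hs⟩ := crossedExtension_isFactorSet f
  obtain ⟨s', hs'⟩ := crossedExtension_isFactorSet f'
  constructor
  · intro h
    obtain ⟨t, ht⟩ := hs.of_equivalent h
    exact ht.exists_eq_mul_huD1 hs'
  · rintro ⟨c, hc⟩
    have h := hs.mul_huD1 c
    rw [← hc] at h
    exact h.equivalent hs'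

theorem huH2_mk_eq_iff (f f' : (huD2 G A).ker) :
    (f : HuH2 G A) = f' ↔ ∃ c : C(G, A), f'.1 = f.1 * huD1 G A c := by
  rw [QuotientGroup.eq, Subgroup.mem_subgroupOf, MonoidHom.mem_range]
  exact exists_congr fun c => by
    rw [Subgroup.coe_mul, Subgroup.coe_inv, eq_inv_mul_iff_mul_eq, eq_comm]

/-- The map `H²(G, A) → Opext_s(G, A)` sending the class of `f` to that of its crossed product. -/
def huH2ToOpext : HuH2 G A → Opext G A :=
  Quotient.lift (fun f => Quotient.mk (OpextData.setoid G A) (crossedExtension f))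
    fun f f' h => Quotient.sound ((crossedExtension_equivalent_iff f f').2
      ((huH2_mk_eq_iff f f').1 (Quotient.sound h)))

theorem huH2ToOpext_bijective : Function.Bijective (huH2ToOpext (G := G) (A := A)) := by
  constructor
  · intro x y hxy
    obtain ⟨f, rfl⟩ := QuotientGroup.mk_surjective x
    obtain ⟨f', rfl⟩ := QuotientGroup.mk_surjective y
    exact (huH2_mk_eq_iff f f').2
      ((crossedExtension_equivalent_iff f f').1 (Quotient.exact hxy))
  · intro x
    obtain ⟨e, rfl⟩ := Quotient.exists_rep x
    obtain ⟨s, f, hs⟩ := e.exists_isFactorSet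
    obtain ⟨t, ht⟩ := crossedExtension_isFactorSet f
    exact ⟨(f : HuH2 G A), Quotient.sound (ht.equivalent hs)⟩

theorem huH2ToOpext_mul (x y : HuH2 G A) :
    huH2ToOpext (x * y) = Opext.baerSum (huH2ToOpext x) (huH2ToOpext y) := by
  obtain ⟨f, rfl⟩ := QuotientGroup.mk_surjective x
  obtain ⟨f', rfl⟩ := QuotientGroup.mk_surjective y
  obtain ⟨s, hs⟩ := crossedExtension_isFactorSet f
  obtain ⟨s', hs'⟩ := crossedExtension_isFactorSet f'
  obtain ⟨t, ht⟩ := crossedExtension_isFactorSet (f * f')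
  obtain ⟨t', ht'⟩ := hs.baer hs'
  exact Quotient.sound (ht.equivalent ht')

end Isomorphism

/-- `Opext_s(G, A)` is an abelian group under the Baer sum, and this group is isomorphic to Hu's
`H²(G, A)`. -/
theorem theorem1p8 (G : Type u) (A : Type v) [Group G] [TopologicalSpace G]
    [IsTopologicalGroup G] [CommGroup A] [TopologicalSpace A] [IsTopologicalGroup A]
    [MulDistribMulAction G A] [ContinuousSMul G A] :
    ∃ _ : CommGroup (Opext G A),
      (∀ x y : Opext G A, x * y = Opext.baerSum x y) ∧
        Nonempty (HuH2 G A ≃* Opext G A) := by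
  let φ : HuH2 G A ≃ Opext G A := Equiv.ofBijective huH2ToOpext huH2ToOpext_bijective
  let _ : CommGroup (Opext G A) := φ.symm.commGroup
  refine ⟨inferInstance, fun x y => ?_, ⟨(φ.symm.mulEquiv).symm⟩⟩
  change φ (φ.symm x * φ.symm y) = _
  rw [show φ (φ.symm x * φ.symm y) = _ from huH2ToOpext_mul _ _]
  exact congrArg₂ _ (φ.apply_symm_apply x) (φ.apply_symm_apply y)
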